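/- Let $n\ge 1$ be an integer, let $[n]=\{1,\dots,n\}$, and let $\mathfrak S_n$ be the set of permutations $\pi=\pi_1\pi_2\cdots\pi_n$ of $[n]$, with the convention $\pi_0=\pi_{n+1}=\infty$. A value $\pi_i$ with $i\in[n]$ is a pinnacle of $\pi$ if $\pi_{i-1}<\pi_i>\pi_{i+1}$, and a vale of $\pi$ if $\pi_{i-1}>\pi_i<\pi_{i+1}$. Let $\mathrm{Pin}(\pi)\subseteq[n]$ and $\mathrm{Vale}(\pi)\subseteq[n]$ be the sets of pinnacles and of vales of $\pi$. For $P\subseteq[n]$ put $\mathrm{Pin}(P;n)=\{\pi\in\mathfrak S_n:\mathrm{Pin}(\pi)=P\}$, and call $P$ an $n$-admissible pinnacle set if $\mathrm{Pin}(P;n)\neq\emptyset$. Let $\mathcal V(P)$ be the set of all $V\subseteq[n]\setminus P$ for which some $\pi\in\mathfrak S_n$ has $\mathrm{Pin}(\pi)=P$ and $\mathrm{Vale}(\pi)=V$. For $V\in\mathcal V(P)$ and $k\in[n]$ put $$N_{PV}(k)=|\{v\in V: v<k\}|-|\{p\in P: p<k\}|.$$ Theorem. If $P$ is an $n$-admissible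 pinnacle set, then $$|\mathrm{Pin}(P;n)|=2^{\,n-|P|-1}\sum_{V\in\mathcal V(P)}\ \prod_{p\in P}\binom{N_{PV}(p)}{2}\prod_{x\in[n]\setminus(P\cup V)}N_{PV}(x).$$ -/

import Mathlib

namespace Pinnacle

/-- `[n] = {1, …, n}`. -/
abbrev interval (n : ℕ) : Finset ℕ := Finset.Icc 1 n

/-- The symmetric group of all permutations of `{1, …, n}`. -/
abbrev Sym (n : ℕ) : Type := Equiv.Perm {i : ℕ // i ∈ interval n}

/-- The one-line notation `π_1 π_2 ⋯ π_n` of a permutation, extended by the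
convention `π_0 = π_{n+1} = ∞` (every index outside `{1, …, n}` carries `∞`). -/
def letter {n : ℕ} (π : Sym n) (i : ℕ) : ℕ∞ :=
  if h : i ∈ interval n then ((π ⟨i, h⟩ : ℕ) : ℕ∞) else ⊤

/-- The pinnacle set: all values `k ∈ [n]` such that `k = π_i` for some `i ∈ [n]`
with `π_{i-1} < π_i > π_{i+1}`. -/
def pinnacleSet {n : ℕ} (π : Sym n) : Finset ℕ :=
  {k ∈ interval n | ∃ i ∈ interval n,
    letter π i = (k : ℕ∞) ∧ letter π (i - 1) < letter π i ∧ letter π (i + 1) < letter π i}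

/-- The vale set: all values `k ∈ [n]` such that `k = π_i` for some `i ∈ [n]`
with `π_{i-1} > π_i < π_{i+1}`. -/
def valeSet {n : ℕ} (π : Sym n) : Finset ℕ :=
  {k ∈ interval n | ∃ i ∈ interval n,
    letter π i = (k : ℕ∞) ∧ letter π i < letter π (i - 1) ∧ letter π i < letter π (i + 1)}

/-- `Pin(P; n)`: all permutations of `{1, …, n}` with pinnacle set `P`. -/
def pinClass (n : ℕ) (P : Finset ℕ) : Finset (Sym n) :=
  {π : Sym n | pinnacleSet π = P}

/-- `P ⊆ [n]` is an `n`-admissible pinnacle set. -/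
def IsAdmissible (n : ℕ) (P : Finset ℕ) : Prop :=
  P ⊆ interval n ∧ (pinClass n P).Nonempty

/-- `𝒱(P)`: all `V ⊆ [n] \ P` such that some permutation of `{1, …, n}` has pinnacle set `P`
and vale set `V`. -/
def valeSets (n : ℕ) (P : Finset ℕ) : Finset (Finset ℕ) :=
  {V ∈ (interval n \ P).powerset | ∃ π : Sym n, pinnacleSet π = P ∧ valeSet π = V}

/-- `N_{PV}(k)`: the number of elements of `V` below `k` minus the number of elements of `P`
below `k`, as an integer. -/
def excess (P V : Finset ℕ) (k : ℕ) : ℤ :=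
  (({v ∈ V | v < k} : Finset ℕ).card : ℤ) - (({p ∈ P | p < k} : Finset ℕ).card : ℤ)

end Pinnacle

/-! Build a permutation by placing 1, 2, …, n in increasing order, the values placed so far forming
a collection of blocks. A new value exceeds everything placed, so it opens a block (and becomes a
vale), extends a block at one end (neither vale nor pinnacle), or joins two blocks (pinnacle). Once
P and V are prescribed, the number of blocks before k is placed is forced to be N = `excess P V k`.
Disregarding the order of the blocks, a vale has 1 choice, a pinnacle N(N-1), and any other value
2N. Each non-vale thus yields a factor 2, and ending with one block forces |V| = |P| + 1. Summing
over V gives the theorem.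

The proof encodes this in weights. `forestWeight` is the insertion recursion for ordered blocks;
`arrangementWeight_eq` shows, by cutting words at their maximum, that for one block it is the
weighted sum over words. With indicator weights, `wordWeight_word` makes that sum count
permutations, and `forestWeight_interval` solves the recursion. -/

namespace Pinnacle

/-! ### Weighted words and the block recursion -/

section Weights

/-- The weight of a letter `a`: `x a`, `y a` or `z a` according to whether `a` is smaller than
both neighbours, smaller than none of them, or smaller than exactly one of them. -/
def letterWeight (x y z : ℕ → ℤ) (a : ℕ) (s t : Prop) [Decidable s] [Decidable t] : ℤ :=
  if s then (if t then x a else z a) else (if t then z a else y a)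

/-- The first letter of a word, with the convention that the empty word starts with `∞`. -/
def headLetter : List ℕ → ℕ∞
  | [] => ⊤
  | a :: _ => a

open Classical in
/-- The product of the weights of the letters of a word that is preceded by the letter `p` and
followed by `∞`. -/
noncomputable def wordWeight (x y z : ℕ → ℤ) : ℕ∞ → List ℕ → ℤ
  | _, [] => 1
  | p, a :: l =>
    letterWeight x y z a ((a : ℕ∞) < p) ((a : ℕ∞) < headLetter l) * wordWeight x y z a l

/-- The total weight of the ways to arrange the elements of `S` in `b` linearly ordered nonempty
words, given by recursion on the largest element of `S`. -/
def forestWeight (x y z : ℕ → ℤ) (S : Finset ℕ) : ℕ → ℤ :=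
  if h : S.Nonempty then fun b =>
    b * (x (S.max' h) * forestWeight x y z (S.erase (S.max' h)) (b - 1)
      + 2 * z (S.max' h) * forestWeight x y z (S.erase (S.max' h)) b
      + y (S.max' h) * forestWeight x y z (S.erase (S.max' h)) (b + 1))
  else fun b => if b = 0 then 1 else 0
termination_by S.card
decreasing_by all_goals exact Finset.card_erase_lt_of_mem (S.max'_mem h)

variable (x y z : ℕ → ℤ)

lemma forestWeight_empty (b : ℕ) : forestWeight x y z ∅ b = if b = 0 then 1 else 0 := by
  rw [forestWeight]; simp

/-- To end with `b` blocks, the maximum is alone in one of `b` places, at one of `2 * b` ends, or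
fills one of the `b` gaps between `b + 1` consecutive blocks. -/
lemma forestWeight_insert {S : Finset ℕ} {m : ℕ} (hm : ∀ a ∈ S, a < m) (b : ℕ) :
    forestWeight x y z (insert m S) b = b * (x m * forestWeight x y z S (b - 1)
      + 2 * z m * forestWeight x y z S b + y m * forestWeight x y z S (b + 1)) := by
  have hne : (insert m S).Nonempty := Finset.insert_nonempty m S
  have hmax : (insert m S).max' hne = m := by
    apply le_antisymm
    · refine Finset.max'_le _ _ _ fun a ha => ?_
      rcases Finset.mem_insert.1 ha with h | h
      · exact h.le
      · exact (hm a h).le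
    · exact Finset.le_max' _ _ (Finset.mem_insert_self m S)
  rw [forestWeight, dif_pos hne]
  simp only [hmax]
  rw [Finset.erase_insert fun h => lt_irrefl _ (hm m h)]

lemma forestWeight_zero (S : Finset ℕ) :
    forestWeight x y z S 0 = if S = ∅ then 1 else 0 := by
  induction S using Finset.induction_on_max with
  | empty => simp [forestWeight_empty]
  | insert m S hm _ => simp [forestWeight_insert x y z hm]

/-- A row of `a + c` blocks splits into its first `a` and last `c`; `A` is the set of letters used
by the first part. Algebraically, the largest letter lies on one side or the other. -/
lemma sum_forestWeight_mul (S : Finset ℕ) (a c : ℕ) :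
    ∑ A ∈ S.powerset, forestWeight x y z A a * forestWeight x y z (S \ A) c
      = forestWeight x y z S (a + c) := by
  induction S using Finset.induction_on_max generalizing a c with
  | empty =>
    simp only [Finset.powerset_empty, Finset.sum_singleton, Finset.sdiff_empty,
      forestWeight_empty]
    by_cases ha : a = 0 <;> simp [ha]
  | insert m S hm ih =>
    have hmS : m ∉ S := fun h => lt_irrefl _ (hm m h)
    rw [Finset.sum_powerset_insert hmS, forestWeight_insert x y z hm]
    have h1 : ∀ A ∈ S.powerset,
        forestWeight x y z A a * forestWeight x y z (insert m S \ A) c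
          = c * (x m * (forestWeight x y z A a * forestWeight x y z (S \ A) (c - 1))
            + 2 * z m * (forestWeight x y z A a * forestWeight x y z (S \ A) c)
            + y m * (forestWeight x y z A a * forestWeight x y z (S \ A) (c + 1))) := by
      intro A hA
      rw [Finset.mem_powerset] at hA
      rw [Finset.insert_sdiff_of_notMem _ fun h => hmS (hA h),
        forestWeight_insert x y z fun b hb => hm b (Finset.sdiff_subset hb)]
      ring
    have h2 : ∀ A ∈ S.powerset,
        forestWeight x y z (insert m A) a * forestWeight x y z (insert m S \ insert m A) c
          = a * (x m * (forestWeight x y z A (a - 1) * forestWeight x y z (S \ A) c)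
            + 2 * z m * (forestWeight x y z A a * forestWeight x y z (S \ A) c)
            + y m * (forestWeight x y z A (a + 1) * forestWeight x y z (S \ A) c)) := by
      intro A hA
      rw [Finset.mem_powerset] at hA
      have : insert m S \ insert m A = S \ A := by
        ext b
        simp only [Finset.mem_sdiff, Finset.mem_insert]
        grind
      rw [this, forestWeight_insert x y z fun b hb => hm b (hA hb)]
      ring
    rw [Finset.sum_congr rfl h1, Finset.sum_congr rfl h2]
    simp only [← Finset.mul_sum, Finset.sum_add_distrib, ih]
    rcases a with _ | a <;> rcases c with _ | c
    · simp
    · simp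
    · simp
    · have e1 : a + 1 + (c + 1 - 1) = a + c + 1 := by omega
      have e2 : a + 1 - 1 + (c + 1) = a + c + 1 := by omega
      have e3 : a + 1 + (c + 1) - 1 = a + c + 1 := by omega
      have e4 : a + 1 + 1 + (c + 1) = a + 1 + (c + 1) + 1 := by omega
      have e5 : a + 1 + (c + 1 + 1) = a + 1 + (c + 1) + 1 := by omega
      rw [e1, e2, e3, e4, e5]
      push_cast
      ring

/-- A maximal letter `m` compares with the other letters exactly as `∞` does, so cutting there
leaves their weights unchanged; `m` itself is below a neighbour only where a side is empty. -/
lemma wordWeight_append_cons {m : ℕ} {l₁ l₂ : List ℕ} (h₁ : ∀ a ∈ l₁, a < m)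
    (h₂ : ∀ a ∈ l₂, a < m) (p : ℕ∞) (hp : (m : ℕ∞) < p ∨ l₁ ≠ []) :
    wordWeight x y z p (l₁ ++ m :: l₂) =
      wordWeight x y z p l₁ * letterWeight x y z m (l₁ = []) (l₂ = []) *
        wordWeight x y z ⊤ l₂ := by
  have key : wordWeight x y z m l₂ = wordWeight x y z ⊤ l₂ := by
    cases l₂ with
    | nil => rfl
    | cons a l => simp [wordWeight, h₂ a (by simp)]
  have key' : ((m : ℕ∞) < headLetter l₂) ↔ l₂ = [] := by
    cases l₂ with
    | nil => simp [headLetter]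
    | cons a l => simpa [headLetter] using (h₂ a (by simp)).le
  -- The hypothesis on `p` is dropped for the induction, since the preceding letter changes at each
  -- step.
  have main : ∀ l₁ : List ℕ, (∀ a ∈ l₁, a < m) → ∀ p : ℕ∞,
      wordWeight x y z p (l₁ ++ m :: l₂) =
        wordWeight x y z p l₁ *
          (if l₁ = [] then (if (m : ℕ∞) < p then (if l₂ = [] then x m else z m)
            else (if l₂ = [] then z m else y m)) else (if l₂ = [] then z m else y m)) *
          wordWeight x y z ⊤ l₂ := by
    intro l₁
    induction l₁ with
    | nil => intro _ p; simp [wordWeight, letterWeight, key, key']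
    | cons a l ih =>
      intro h p
      have ham : a < m := h a (by simp)
      rw [List.cons_append, wordWeight, ih (fun b hb => h b (by simp [hb])), wordWeight]
      cases l with
      | nil => simp [headLetter, ham, wordWeight, letterWeight, ham.le, not_lt.2, mul_assoc]
      | cons b l => simp [headLetter, mul_assoc]
  rw [main l₁ h₁ p, letterWeight]
  rcases hp with hp | hp <;> simp [hp]

/-- The words that use every element of `S` exactly once. -/
def arrangements (S : Finset ℕ) : Finset (List ℕ) := S.val.lists.toFinset

lemma mem_arrangements {S : Finset ℕ} {l : List ℕ} :
    l ∈ arrangements S ↔ l.Nodup ∧ ∀ a, a ∈ l ↔ a ∈ S := by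
  rw [arrangements, Multiset.mem_toFinset, Multiset.mem_lists_iff]
  constructor
  · intro h
    have h' : S.val = (l : Multiset ℕ) := h
    refine ⟨Multiset.coe_nodup.1 (h' ▸ S.nodup), fun a => ?_⟩
    rw [← Finset.mem_val, h', Multiset.mem_coe]
  · rintro ⟨h1, h2⟩
    exact (Multiset.Nodup.ext S.nodup (Multiset.coe_nodup.2 h1)).2 fun a => by simp [h2]

/-- The total weight of the words that use every element of `S` exactly once. -/
noncomputable def arrangementWeight (S : Finset ℕ) : ℤ :=
  ∑ l ∈ arrangements S, wordWeight x y z ⊤ l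

lemma arrangementWeight_insert {S : Finset ℕ} {m : ℕ} (hm : ∀ a ∈ S, a < m) :
    arrangementWeight x y z (insert m S) =
      ∑ A ∈ S.powerset, arrangementWeight x y z A *
        letterWeight x y z m (A = ∅) (S \ A = ∅) * arrangementWeight x y z (S \ A) := by
  have hmS : m ∉ S := fun h => lt_irrefl _ (hm m h)
  have hR : ∀ A ∈ S.powerset, arrangementWeight x y z A *
        letterWeight x y z m (A = ∅) (S \ A = ∅) * arrangementWeight x y z (S \ A)
      = ∑ q ∈ arrangements A ×ˢ arrangements (S \ A), wordWeight x y z ⊤ (q.1 ++ m :: q.2) := by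
    intro A hA
    rw [Finset.mem_powerset] at hA
    rw [Finset.sum_product, arrangementWeight, arrangementWeight, Finset.sum_mul, Finset.sum_mul]
    refine Finset.sum_congr rfl fun l₁ h₁ => ?_
    rw [Finset.mul_sum]
    refine Finset.sum_congr rfl fun l₂ h₂ => ?_
    have e₁ := (mem_arrangements.1 h₁).2
    have e₂ := (mem_arrangements.1 h₂).2
    rw [wordWeight_append_cons x y z (fun a ha => hm a (hA ((e₁ a).1 ha)))
      (fun a ha => hm a (Finset.sdiff_subset ((e₂ a).1 ha))) ⊤ (Or.inl (by simp))]
    have i₁ : l₁ = [] ↔ A = ∅ := by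
      rw [List.eq_nil_iff_forall_not_mem, Finset.eq_empty_iff_forall_notMem]
      simp only [e₁]
    have i₂ : l₂ = [] ↔ S \ A = ∅ := by
      rw [List.eq_nil_iff_forall_not_mem, Finset.eq_empty_iff_forall_notMem]
      simp only [e₂]
    simp only [letterWeight, i₁, i₂]
  rw [Finset.sum_congr rfl hR, Finset.sum_sigma', arrangementWeight]
  symm
  refine Finset.sum_bij (fun q _ => q.2.1 ++ m :: q.2.2) ?_ ?_ ?_ (fun _ _ => rfl)
  · rintro ⟨A, l₁, l₂⟩ h
    simp only [Finset.mem_sigma, Finset.mem_product, Finset.mem_powerset, mem_arrangements] at h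
    obtain ⟨hA, ⟨n₁, e₁⟩, n₂, e₂⟩ := h
    rw [mem_arrangements]
    simp only [List.nodup_append, List.nodup_cons, List.mem_append, List.mem_cons, e₁, e₂,
      Finset.mem_sdiff, Finset.mem_insert]
    grind
  · rintro ⟨A, l₁, l₂⟩ h ⟨A', l₁', l₂'⟩ h' he
    simp only [Finset.mem_sigma, Finset.mem_product, Finset.mem_powerset, mem_arrangements] at h h'
    obtain ⟨hA, ⟨n₁, e₁⟩, n₂, e₂⟩ := h
    obtain ⟨hA', ⟨n₁', e₁'⟩, n₂', e₂'⟩ := h'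
    have hne : m ∉ l₁ := fun hh => hmS (hA ((e₁ m).1 hh))
    have hne₂ : m ∉ l₂ := fun hh => hmS (Finset.sdiff_subset ((e₂ m).1 hh))
    obtain ⟨rfl, rfl⟩ := (List.append_cons_inj_of_notMem hne hne₂).1 he |>.imp_right And.right
    obtain rfl : A = A' := by ext a; rw [← e₁, ← e₁']
    rfl
  · intro l hl
    rw [mem_arrangements] at hl
    obtain ⟨hn, he⟩ := hl
    obtain ⟨l₁, l₂, rfl⟩ := List.append_of_mem ((he m).2 (Finset.mem_insert_self m S))
    simp only [List.nodup_append, List.nodup_cons, List.mem_append, List.mem_cons,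
      Finset.mem_insert] at hn he
    refine ⟨⟨l₁.toFinset, l₁, l₂⟩, ?_, rfl⟩
    simp only [Finset.mem_sigma, Finset.mem_product, Finset.mem_powerset, mem_arrangements,
      Finset.subset_iff, List.mem_toFinset, Finset.mem_sdiff]
    grind

lemma arrangementWeight_eq (S : Finset ℕ) :
    arrangementWeight x y z S = forestWeight x y z S 1 + forestWeight x y z S 0 := by
  induction S using Finset.strongInduction with
  | H S ih =>
  rcases S.eq_empty_or_nonempty with rfl | hne
  · have : arrangements ∅ = {[]} := by
      ext l
      rw [mem_arrangements, Finset.mem_singleton, List.eq_nil_iff_forall_not_mem]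
      constructor
      · rintro ⟨-, h⟩; simpa using h
      · intro h
        obtain rfl := List.eq_nil_iff_forall_not_mem.2 h
        simp
    simp [arrangementWeight, this, wordWeight, forestWeight_empty]
  obtain ⟨m, T, hm, rfl⟩ : ∃ m T, (∀ a ∈ T, a < m) ∧ S = insert m T :=
    ⟨S.max' hne, S.erase (S.max' hne), fun a ha => S.lt_max'_of_mem_erase_max' hne ha,
      (Finset.insert_erase (S.max'_mem hne)).symm⟩
  have hmT : m ∉ T := fun h => lt_irrefl _ (hm m h)
  have hlt : ∀ A, A ⊆ T → A ⊂ insert m T := fun A hA =>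
    lt_of_le_of_lt hA (Finset.ssubset_insert hmT)
  -- `forestWeight` at 0 detects the empty set and at 1 vanishes on it, so the four cases of
  -- `letterWeight` become four products to which the convolution applies.
  have hterm : ∀ A ∈ T.powerset, arrangementWeight x y z A *
        letterWeight x y z m (A = ∅) (T \ A = ∅) * arrangementWeight x y z (T \ A)
      = y m * (forestWeight x y z A 1 * forestWeight x y z (T \ A) 1)
        + z m * (forestWeight x y z A 1 * forestWeight x y z (T \ A) 0)
        + z m * (forestWeight x y z A 0 * forestWeight x y z (T \ A) 1)
        + x m * (forestWeight x y z A 0 * forestWeight x y z (T \ A) 0) := by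
    intro A hA
    rw [Finset.mem_powerset] at hA
    have hone : ∀ B, B = ∅ → forestWeight x y z B 1 = 0 := by
      rintro B rfl
      simp [forestWeight_empty]
    rw [ih A (hlt A hA), ih (T \ A) (hlt _ Finset.sdiff_subset), forestWeight_zero,
      forestWeight_zero, letterWeight]
    generalize T \ A = B
    by_cases h1 : A = ∅ <;> by_cases h2 : B = ∅ <;> simp only [h1, h2, hone, if_true, if_false]
      <;> ring
  rw [arrangementWeight_insert x y z hm, Finset.sum_congr rfl hterm,
    forestWeight_insert x y z hm, forestWeight_insert x y z hm]
  simp only [← Finset.mul_sum, Finset.sum_add_distrib, sum_forestWeight_mul]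
  push_cast
  simp
  ring

end Weights

/-! ### Solving the recursion for prescribed pinnacles and vales -/

section Evaluation

/-- The indicator function of `S`. -/
def indicator (S : Finset ℕ) (a : ℕ) : ℤ := if a ∈ S then 1 else 0

/-- The indicator function of the complement of `S`. -/
def coindicator (S : Finset ℕ) (a : ℕ) : ℤ := if a ∈ S then 0 else 1

/-- The number of ordered ways in which the value `a` can join the words formed by smaller
values; a vale is counted once. -/
def insertionCount (P V : Finset ℕ) (a : ℕ) : ℤ :=
  if a ∈ V then 1 else if a ∈ P then excess P V a * (excess P V a - 1) else 2 * excess P V a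

variable {P V : Finset ℕ}

lemma card_filter_lt_succ (S : Finset ℕ) (k : ℕ) :
    (({v ∈ S | v < k + 1} : Finset ℕ).card : ℤ)
      = (({v ∈ S | v < k} : Finset ℕ).card : ℤ) + indicator S k := by
  have h : ({v ∈ S | v < k + 1} : Finset ℕ)
      = ({v ∈ S | v < k} : Finset ℕ) ∪ (if k ∈ S then {k} else ∅) := by
    ext a
    split_ifs <;> simp <;> grind
  rw [h, Finset.card_union_of_disjoint]
  · unfold indicator; split_ifs <;> simp
  · split_ifs <;> simp

lemma excess_succ (k : ℕ) :
    excess P V (k + 1) = excess P V k + indicator V k - indicator P k := by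
  simp only [excess, card_filter_lt_succ]
  ring

lemma excess_one (hP : 0 ∉ P) (hV : 0 ∉ V) : excess P V 1 = 0 := by
  have h : ∀ S : Finset ℕ, 0 ∉ S → ({v ∈ S | v < 1} : Finset ℕ) = ∅ := by
    intro S hS
    ext a
    simp only [Finset.mem_filter, Nat.lt_one_iff, Finset.notMem_empty, iff_false, not_and]
    rintro ha rfl
    exact hS ha
  rw [excess, h P hP, h V hV]
  simp

lemma prod_insertionCount_succ (k : ℕ) :
    ∏ a ∈ interval (k + 1), insertionCount P V a
      = (∏ a ∈ interval k, insertionCount P V a) * insertionCount P V (k + 1) :=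
  Finset.prod_Icc_succ_top (by omega) _

/-- If 1 is not a vale, its factor has excess 0. Otherwise the excess starts positive and can first
reach 0 only through a pinnacle at excess 1, whose factor is 1 · 0. -/
lemma prod_insertionCount_eq_zero (hP : 0 ∉ P) (hV : 0 ∉ V) (hPV : Disjoint P V) (k : ℕ)
    (h : excess P V (k + 2) ≤ 0) : ∏ a ∈ interval (k + 1), insertionCount P V a = 0 := by
  induction k with
  | zero =>
    rw [prod_insertionCount_succ]
    have h1 := excess_one hP hV
    rw [excess_succ, h1] at h
    unfold insertionCount
    by_cases hv : 1 ∈ V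
    · have := Finset.disjoint_right.1 hPV hv
      simp [indicator, hv, this] at h
    · simp [hv, h1]
  | succ k ih =>
    rw [prod_insertionCount_succ]
    by_cases h0 : excess P V (k + 2) ≤ 0
    · rw [ih h0, zero_mul]
    · rw [excess_succ] at h
      have e : excess P V (k + 1 + 1) = excess P V (k + 2) := rfl
      have hv : k + 2 ∉ V := by
        intro hv
        have := Finset.disjoint_right.1 hPV hv
        simp [indicator, hv, this] at h
        omega
      have hp : k + 2 ∈ P := by
        by_contra hp
        simp [indicator, hv, hp] at h
        omega
      simp [indicator, hv, hp] at h
      have h1 : excess P V (k + 2) = 1 := by omega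
      simp [insertionCount, hv, hp, h1]

/-- The weights kill all but one term of the recursion, so the block count is determined;
`b.factorial` records the orders of the blocks. -/
lemma forestWeight_interval (hP : 0 ∉ P) (hV : 0 ∉ V) (hPV : Disjoint P V) (k b : ℕ) :
    forestWeight (indicator V) (indicator P) (coindicator (P ∪ V)) (interval k) b
      = if (b : ℤ) = excess P V (k + 1) then
          (b.factorial : ℤ) * ∏ a ∈ interval k, insertionCount P V a else 0 := by
  induction k generalizing b with
  | zero =>
    have : interval 0 = ∅ := rfl
    rw [this, forestWeight_empty, excess_one hP hV]
    by_cases hb : b = 0 <;> simp [hb]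
  | succ k ih =>
    have hk : interval (k + 1) = insert (k + 1) (interval k) :=
      (Finset.insert_Icc_right_eq_Icc_add_one (by omega)).symm
    have hlt : ∀ a ∈ interval k, a < k + 1 := fun a ha => by
      rw [Finset.mem_Icc] at ha; omega
    have hzero := prod_insertionCount_eq_zero hP hV hPV k
    rw [hk, forestWeight_insert _ _ _ hlt, ← hk, ih, ih, ih]
    -- With no blocks the left side vanishes, so the product must vanish too when the excess is 0.
    rcases b with _ | b
    · by_cases h0 : ((0 : ℕ) : ℤ) = excess P V (k + 1 + 1)
      · rw [if_pos h0, hzero (le_of_eq (by simpa using h0.symm))]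
        simp
      · rw [if_neg h0]; simp
    rw [prod_insertionCount_succ]
    rw [excess_succ (k + 1)]
    generalize hN : excess P V (k + 1) = N
    generalize ∏ a ∈ interval k, insertionCount P V a = Q
    unfold insertionCount indicator coindicator
    rw [hN]
    by_cases hv : k + 1 ∈ V
    · have hp := Finset.disjoint_right.1 hPV hv
      simp only [hv, hp, Finset.mem_union, if_true, if_false, or_true, Nat.factorial_succ,
        Nat.add_sub_cancel]
      by_cases h : (b : ℤ) = N
      · rw [if_pos h, if_pos (show ((b + 1 : ℕ) : ℤ) = N + 1 - 0 by push_cast at *; omega)]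
        push_cast; ring
      · rw [if_neg h, if_neg (show ¬((b + 1 : ℕ) : ℤ) = N + 1 - 0 by push_cast at *; omega)]; ring
    by_cases hp : k + 1 ∈ P
    · simp only [hv, hp, Finset.mem_union, if_true, if_false, or_false, Nat.factorial_succ]
      by_cases h : ((b + 1 + 1 : ℕ) : ℤ) = N
      · rw [if_pos h, if_pos (show ((b + 1 : ℕ) : ℤ) = N + 0 - 1 by push_cast at *; omega), ← h]
        push_cast; ring
      · rw [if_neg h, if_neg (show ¬((b + 1 : ℕ) : ℤ) = N + 0 - 1 by push_cast at *; omega)]; ring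
    · simp only [hv, hp, Finset.mem_union, if_false, or_false, Nat.factorial_succ]
      by_cases h : ((b + 1 : ℕ) : ℤ) = N
      · rw [if_pos h, if_pos (show ((b + 1 : ℕ) : ℤ) = N + 0 - 0 by push_cast at *; omega), ← h]
        push_cast; ring
      · rw [if_neg h, if_neg (show ¬((b + 1 : ℕ) : ℤ) = N + 0 - 0 by push_cast at *; omega)]; ring

lemma two_mul_choose_two (N : ℤ) : 2 * Ring.choose N 2 = N * (N - 1) := by
  have h := Ring.descPochhammer_eq_factorial_smul_choose N 2
  rw [← Polynomial.eval_eq_smeval] at h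
  simp [descPochhammer_succ_right] at h
  linarith

lemma prod_insertionCount {n : ℕ} (hP : P ⊆ interval n) (hV : V ⊆ interval n)
    (hPV : Disjoint P V) :
    ∏ a ∈ interval n, insertionCount P V a
      = 2 ^ (n - V.card) * ((∏ p ∈ P, Ring.choose (excess P V p) 2) *
          ∏ a ∈ interval n \ (P ∪ V), excess P V a) := by
  have hsub : P ∪ V ⊆ interval n := Finset.union_subset hP hV
  have hcard : n - V.card = P.card + (interval n \ (P ∪ V)).card := by
    have h1 := Finset.card_sdiff_add_card_eq_card hsub
    rw [Finset.card_union_of_disjoint hPV, Nat.card_Icc] at h1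
    omega
  have h1 : ∀ a ∈ interval n \ (P ∪ V), insertionCount P V a = 2 * excess P V a := by
    intro a ha
    simp only [Finset.mem_sdiff, Finset.mem_union, not_or] at ha
    simp [insertionCount, ha.2.1, ha.2.2]
  have h2 : ∀ a ∈ P, insertionCount P V a = 2 * Ring.choose (excess P V a) 2 := by
    intro a ha
    simp [insertionCount, ha, Finset.disjoint_left.1 hPV ha, two_mul_choose_two]
  have h3 : ∀ a ∈ V, insertionCount P V a = 1 := fun a ha => by simp [insertionCount, ha]
  rw [← Finset.prod_sdiff hsub, Finset.prod_union hPV, Finset.prod_congr rfl h1,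
    Finset.prod_congr rfl h2, Finset.prod_congr rfl h3, Finset.prod_mul_distrib,
    Finset.prod_mul_distrib, hcard, pow_add]
  simp only [Finset.prod_const]
  ring

lemma excess_top {n : ℕ} (hP : P ⊆ interval n) (hV : V ⊆ interval n) :
    excess P V (n + 1) = (V.card : ℤ) - P.card := by
  have h : ∀ S : Finset ℕ, S ⊆ interval n → ({v ∈ S | v < n + 1} : Finset ℕ) = S := by
    intro S hS
    refine Finset.filter_true_of_mem fun a ha => ?_
    have := Finset.mem_Icc.1 (hS ha)
    omega
  rw [excess, h P hP, h V hV]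

end Evaluation

/-! ### From permutations to words -/

section Words

variable {n : ℕ}

lemma wordWeight_eq_prod (x y z : ℕ → ℤ) (c : ℕ → ℕ∞) (f : ℕ → ℕ) (k m : ℕ)
    (hc : ∀ i, k < i → i ≤ k + m → c i = f i) (htop : c (k + m + 1) = ⊤) :
    wordWeight x y z (c k) ((List.range' (k + 1) m).map f)
      = ∏ i ∈ Finset.Icc (k + 1) (k + m),
          letterWeight x y z (f i) (c i < c (i - 1)) (c i < c (i + 1)) := by
  induction m generalizing k with
  | zero => simp [wordWeight]
  | succ m ih =>
    have hhead : headLetter ((List.range' (k + 1 + 1) m).map f) = c (k + 1 + 1) := by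
      cases m with
      | zero => simp [headLetter, htop]
      | succ m => simp [List.range'_succ, headLetter, hc (k + 1 + 1) (by omega) (by omega)]
    have hk := hc (k + 1) (by omega) (by omega)
    have := ih (k + 1) (fun i hi hi' => hc i (by omega) (by omega))
      (by rw [← htop]; congr 1; omega)
    rw [List.range'_succ, List.map_cons, wordWeight, ← hk, hhead, this,
      show k + (m + 1) = k + 1 + m by omega,
      ← Finset.mul_prod_Ioc_eq_prod_Icc (a := k + 1) (b := k + 1 + m) (by omega)]
    congr 1
    refine Finset.prod_congr ?_ fun _ _ => rfl
    ext i
    simp only [Finset.mem_Icc, Finset.mem_Ioc]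
    omega

/-- The one-line notation of a permutation as a list. -/
def word (π : Sym n) : List ℕ :=
  (List.range' 1 n).map fun i => if h : i ∈ interval n then (π ⟨i, h⟩ : ℕ) else 0

lemma letter_of_mem (π : Sym n) {i : ℕ} (h : i ∈ interval n) :
    letter π i = ((π ⟨i, h⟩ : ℕ) : ℕ∞) := dif_pos h

lemma letter_of_notMem (π : Sym n) {i : ℕ} (h : i ∉ interval n) : letter π i = ⊤ := dif_neg h

lemma letter_injOn (π : Sym n) {i j : ℕ} (hi : i ∈ interval n) (h : letter π i = letter π j) :
    i = j := by
  by_cases hj : j ∈ interval n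
  · rw [letter_of_mem π hi, letter_of_mem π hj, Nat.cast_inj, Subtype.val_inj,
      π.injective.eq_iff, Subtype.mk.injEq] at h
    exact h
  · rw [letter_of_mem π hi, letter_of_notMem π hj] at h
    exact absurd h (ENat.natCast_ne_top _)

lemma mem_valeSet_iff (π : Sym n) {i : ℕ} (hi : i ∈ interval n) :
    (π ⟨i, hi⟩ : ℕ) ∈ valeSet π ↔
      letter π i < letter π (i - 1) ∧ letter π i < letter π (i + 1) := by
  simp only [valeSet, Finset.mem_filter]
  constructor
  · rintro ⟨-, j, -, hj, h⟩
    rw [← letter_of_mem π hi] at hj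
    obtain rfl := letter_injOn π hi hj.symm
    exact h
  · exact fun h => ⟨(π ⟨i, hi⟩).2, i, hi, letter_of_mem π hi, h⟩

/-- Neighbouring letters are never equal, so both conditions can be phrased by the comparisons that
`letterWeight` uses. -/
lemma mem_pinnacleSet_iff (π : Sym n) {i : ℕ} (hi : i ∈ interval n) :
    (π ⟨i, hi⟩ : ℕ) ∈ pinnacleSet π ↔
      ¬ letter π i < letter π (i - 1) ∧ ¬ letter π i < letter π (i + 1) := by
  have h1 : letter π i ≠ letter π (i - 1) := fun h => by
    have := letter_injOn π hi h
    have := (Finset.mem_Icc.1 hi).1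
    omega
  have h2 : letter π i ≠ letter π (i + 1) := fun h => by
    have := letter_injOn π hi h
    omega
  rw [not_lt, not_lt, h1.symm.le_iff_lt, h2.symm.le_iff_lt]
  simp only [pinnacleSet, Finset.mem_filter]
  constructor
  · rintro ⟨-, j, -, hj, h⟩
    rw [← letter_of_mem π hi] at hj
    obtain rfl := letter_injOn π hi hj.symm
    exact h
  · exact fun h => ⟨(π ⟨i, hi⟩).2, i, hi, letter_of_mem π hi, h⟩

lemma eq_iff_of_subset_interval {S T : Finset ℕ} (hS : S ⊆ interval n) (hT : T ⊆ interval n)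
    (π : Sym n) :
    S = T ↔ ∀ i (hi : i ∈ interval n), (π ⟨i, hi⟩ : ℕ) ∈ S ↔ (π ⟨i, hi⟩ : ℕ) ∈ T := by
  refine ⟨fun h => by simp [h], fun h => ?_⟩
  ext a
  by_cases ha : a ∈ interval n
  · obtain ⟨⟨i, hi⟩, hπ⟩ := π.surjective ⟨a, ha⟩
    have := h i hi
    rwa [hπ] at this
  · exact iff_of_false (fun h => ha (hS h)) fun h => ha (hT h)

/-- Each factor is 1 when the letter's local shape agrees with its membership in `P` and `V`, and 0
otherwise. -/
lemma wordWeight_word {P V : Finset ℕ} (hP : P ⊆ interval n) (hV : V ⊆ interval n)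
    (hPV : Disjoint P V) (π : Sym n) :
    wordWeight (indicator V) (indicator P) (coindicator (P ∪ V)) ⊤ (word π)
      = if pinnacleSet π = P ∧ valeSet π = V then 1 else 0 := by
  have h0 : letter π 0 = ⊤ := letter_of_notMem π (by simp)
  have hprod := wordWeight_eq_prod (indicator V) (indicator P) (coindicator (P ∪ V)) (letter π)
    (fun i => if h : i ∈ interval n then (π ⟨i, h⟩ : ℕ) else 0) 0 n
    (fun i hi hi' => by
      have h : i ∈ interval n := Finset.mem_Icc.2 ⟨hi, by omega⟩
      rw [letter_of_mem π h, dif_pos h])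
    (letter_of_notMem π (by simp))
  rw [h0] at hprod
  rw [word, hprod]
  have hterm : ∀ i (hi : i ∈ interval n),
      letterWeight (indicator V) (indicator P) (coindicator (P ∪ V))
        (if h : i ∈ interval n then (π ⟨i, h⟩ : ℕ) else 0)
        (letter π i < letter π (i - 1)) (letter π i < letter π (i + 1))
      = if ((π ⟨i, hi⟩ : ℕ) ∈ pinnacleSet π ↔ (π ⟨i, hi⟩ : ℕ) ∈ P) ∧
          ((π ⟨i, hi⟩ : ℕ) ∈ valeSet π ↔ (π ⟨i, hi⟩ : ℕ) ∈ V) then 1 else 0 := by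
    intro i hi
    rw [dif_pos hi]
    simp only [mem_pinnacleSet_iff, mem_valeSet_iff]
    have hd : (π ⟨i, hi⟩ : ℕ) ∈ P → (π ⟨i, hi⟩ : ℕ) ∉ V := fun h => Finset.disjoint_left.1 hPV h
    unfold letterWeight indicator coindicator
    by_cases h1 : letter π i < letter π (i - 1) <;>
      by_cases h2 : letter π i < letter π (i + 1) <;>
      by_cases h3 : (π ⟨i, hi⟩ : ℕ) ∈ P <;> by_cases h4 : (π ⟨i, hi⟩ : ℕ) ∈ V <;>
      first
        | exact absurd h4 (hd h3)
        | simp only [h1, h2, h3, h4, Finset.mem_union, not_true, not_false_iff, and_true, and_false,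
            or_true, or_false, iff_true, iff_false, if_true, if_false]
  simp only [zero_add]
  have hsP : pinnacleSet π ⊆ interval n := Finset.filter_subset _ _
  have hsV : valeSet π ⊆ interval n := Finset.filter_subset _ _
  have hiff := and_congr (eq_iff_of_subset_interval hsP hP π) (eq_iff_of_subset_interval hsV hV π)
  split_ifs with h <;> rw [hiff] at h
  · refine Finset.prod_eq_one fun i hi => ?_
    rw [hterm i hi, if_pos ⟨h.1 i hi, h.2 i hi⟩]
  · have : ∃ i, ∃ hi : i ∈ interval n,
        ¬ (((π ⟨i, hi⟩ : ℕ) ∈ pinnacleSet π ↔ (π ⟨i, hi⟩ : ℕ) ∈ P) ∧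
          ((π ⟨i, hi⟩ : ℕ) ∈ valeSet π ↔ (π ⟨i, hi⟩ : ℕ) ∈ V)) := by
      by_contra hcon
      push Not at hcon
      exact h ⟨fun i hi => (hcon i hi).1, fun i hi => (hcon i hi).2⟩
    obtain ⟨i, hi, hne⟩ := this
    refine Finset.prod_eq_zero hi ?_
    rw [hterm i hi, if_neg hne]

lemma word_mem_arrangements (π : Sym n) : word π ∈ arrangements (interval n) := by
  have hmem : ∀ i, i ∈ List.range' 1 n ↔ i ∈ interval n := fun i => by
    rw [List.mem_range'_1, Finset.mem_Icc]; omega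
  rw [mem_arrangements, word]
  constructor
  · refine List.Nodup.map_on (fun i hi j hj h => ?_) List.nodup_range'
    rw [hmem] at hi hj
    rw [dif_pos hi, dif_pos hj] at h
    exact congrArg Subtype.val (π.injective (Subtype.ext h))
  · intro a
    simp only [List.mem_map, hmem]
    constructor
    · rintro ⟨i, hi, rfl⟩
      rw [dif_pos hi]
      exact (π ⟨i, hi⟩).2
    · intro ha
      obtain ⟨⟨i, hi⟩, hπ⟩ := π.surjective ⟨a, ha⟩
      exact ⟨i, hi, by rw [dif_pos hi, hπ]⟩

lemma word_injective : Function.Injective (word (n := n)) := by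
  intro π σ h
  ext ⟨i, hi⟩
  have h' := (List.map_inj_left.1 h) i (by
    rw [List.mem_range'_1]
    have := Finset.mem_Icc.1 hi
    omega)
  rw [dif_pos hi, dif_pos hi] at h'
  exact h'

lemma exists_word_eq {l : List ℕ} (hl : l ∈ arrangements (interval n)) :
    ∃ π : Sym n, word π = l := by
  rw [mem_arrangements] at hl
  obtain ⟨hn, he⟩ := hl
  have hlen : l.length = n := by
    have : l.toFinset = interval n := by ext a; simp only [List.mem_toFinset, he]
    rw [← List.toFinset_card_of_nodup hn, this, Nat.card_Icc]
    omega
  have hb : ∀ i : {i : ℕ // i ∈ interval n}, i.1 - 1 < l.length := fun i => by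
    have := Finset.mem_Icc.1 i.2
    omega
  let f : {i : ℕ // i ∈ interval n} → {i : ℕ // i ∈ interval n} := fun i =>
    ⟨l[i.1 - 1]'(hb i), (he _).1 (List.getElem_mem _)⟩
  have hf : Function.Injective f := by
    intro i j h
    have h' := (hn.getElem_inj_iff (hi := hb i) (hj := hb j)).1 (congrArg Subtype.val h)
    have hi := Finset.mem_Icc.1 i.2
    have hj := Finset.mem_Icc.1 j.2
    exact Subtype.ext (by omega)
  refine ⟨Equiv.ofBijective f (Finite.injective_iff_bijective.1 hf), ?_⟩
  refine List.ext_getElem (by simp [word, hlen]) fun i h₁ h₂ => ?_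
  have hi : 1 + i ∈ interval n := Finset.mem_Icc.2 ⟨by omega, by omega⟩
  simp only [word, List.getElem_map, List.getElem_range', one_mul, dif_pos hi,
    Equiv.ofBijective_apply, f, Nat.add_sub_cancel_left]

lemma card_eq_arrangementWeight {P V : Finset ℕ} (hP : P ⊆ interval n) (hV : V ⊆ interval n)
    (hPV : Disjoint P V) :
    (({π : Sym n | pinnacleSet π = P ∧ valeSet π = V} : Finset (Sym n)).card : ℤ)
      = arrangementWeight (indicator V) (indicator P) (coindicator (P ∪ V)) (interval n) := by
  rw [Finset.card_filter, arrangementWeight]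
  push_cast
  refine Finset.sum_bij (fun π _ => word π) (fun π _ => word_mem_arrangements π)
    (fun π _ σ _ h => word_injective h) (fun l hl => ?_)
    (fun π _ => (wordWeight_word hP hV hPV π).symm)
  obtain ⟨π, h⟩ := exists_word_eq hl
  exact ⟨π, Finset.mem_univ _, h⟩

lemma card_pinnacleSet_valeSet (hn : 1 ≤ n) {P V : Finset ℕ} (hP : P ⊆ interval n)
    (hV : V ⊆ interval n) (hPV : Disjoint P V)
    (h : ∃ π : Sym n, pinnacleSet π = P ∧ valeSet π = V) :
    (({π : Sym n | pinnacleSet π = P ∧ valeSet π = V} : Finset (Sym n)).card : ℤ)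
      = 2 ^ (n - (P.card + 1)) * ((∏ p ∈ P, Ring.choose (excess P V p) 2) *
          ∏ a ∈ interval n \ (P ∪ V), excess P V a) := by
  have hP0 : 0 ∉ P := fun h => by simpa using hP h
  have hV0 : 0 ∉ V := fun h => by simpa using hV h
  have hne : interval n ≠ ∅ := (Finset.nonempty_Icc.2 hn).ne_empty
  have hcard := card_eq_arrangementWeight hP hV hPV
  rw [arrangementWeight_eq, forestWeight_zero, if_neg hne, add_zero,
    forestWeight_interval hP0 hV0 hPV, excess_top hP hV, prod_insertionCount hP hV hPV] at hcard
  have hpos : 0 < ({π : Sym n | pinnacleSet π = P ∧ valeSet π = V} : Finset (Sym n)).card := by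
    obtain ⟨π, hπ⟩ := h
    exact Finset.card_pos.2 ⟨π, by simpa using hπ⟩
  -- The count is positive, so the final block count `V.card - P.card` must be 1.
  split_ifs at hcard with h1
  · have : V.card = P.card + 1 := by omega
    rw [hcard, this]
    simp
  · omega

end Words

end Pinnacle

/-! ### Summation over vale sets -/

theorem mainTheorem1 (n : ℕ) (hn : 1 ≤ n) (P : Finset ℕ) (hP : Pinnacle.IsAdmissible n P) :
    ((Pinnacle.pinClass n P).card : ℚ) =
      (2 : ℚ) ^ ((n : ℤ) - (P.card : ℤ) - 1) *
        ((∑ V ∈ Pinnacle.valeSets n P,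
          (∏ p ∈ P, Ring.choose (Pinnacle.excess P V p) 2) *
            ∏ x ∈ Pinnacle.interval n \ (P ∪ V), Pinnacle.excess P V x : ℤ) : ℚ) := by
  classical
  obtain ⟨hPn, π₀, hπ₀⟩ := hP
  -- The first letter follows `∞` and is no pinnacle, so `P` is not all of [n] and the exponent is a
  -- natural number.
  have hlt : P.card + 1 ≤ n := by
    by_contra hcon
    have hPe : P = Pinnacle.interval n :=
      Finset.eq_of_subset_of_card_le hPn (by rw [Nat.card_Icc]; omega)
    have h1 : 1 ∈ Pinnacle.interval n := Finset.mem_Icc.2 ⟨le_rfl, hn⟩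
    have hmem := (Pinnacle.mem_pinnacleSet_iff π₀ h1).1 (by
      rw [(Finset.mem_filter.1 hπ₀).2, hPe]
      exact (π₀ ⟨1, h1⟩).2)
    refine hmem.1 ?_
    rw [Pinnacle.letter_of_mem π₀ h1, Pinnacle.letter_of_notMem π₀ (by simp)]
    exact ENat.natCast_lt_top _
  have hdisj : ∀ π : Pinnacle.Sym n, Disjoint (Pinnacle.pinnacleSet π) (Pinnacle.valeSet π) := by
    intro π
    rw [Finset.disjoint_left]
    intro a ha hv
    obtain ⟨⟨i, hi⟩, hπ⟩ := π.surjective ⟨a, (Finset.mem_filter.1 ha).1⟩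
    have e : a = (π ⟨i, hi⟩ : ℕ) := by rw [hπ]
    rw [e, Pinnacle.mem_pinnacleSet_iff] at ha
    rw [e, Pinnacle.mem_valeSet_iff] at hv
    exact ha.1 hv.1
  have hsum : (Pinnacle.pinClass n P).card = ∑ V ∈ Pinnacle.valeSets n P,
      ({π : Pinnacle.Sym n | Pinnacle.pinnacleSet π = P ∧ Pinnacle.valeSet π = V} :
        Finset (Pinnacle.Sym n)).card := by
    rw [Finset.card_eq_sum_card_fiberwise (f := Pinnacle.valeSet)
      (t := Pinnacle.valeSets n P)]
    · simp only [Pinnacle.pinClass, Finset.filter_filter]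
    · intro π hπ
      have hπP : Pinnacle.pinnacleSet π = P := by simpa [Pinnacle.pinClass] using hπ
      refine Finset.mem_coe.2 (Finset.mem_filter.2 ⟨Finset.mem_powerset.2 ?_, π, hπP, rfl⟩)
      refine Finset.subset_sdiff.2 ⟨Finset.filter_subset _ _, ?_⟩
      rw [← hπP]
      exact (hdisj π).symm
  have hint : ((Pinnacle.pinClass n P).card : ℤ) = 2 ^ (n - (P.card + 1)) *
      ∑ V ∈ Pinnacle.valeSets n P, (∏ p ∈ P, Ring.choose (Pinnacle.excess P V p) 2) *
        ∏ x ∈ Pinnacle.interval n \ (P ∪ V), Pinnacle.excess P V x := by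
    rw [hsum, Finset.mul_sum]
    push_cast
    refine Finset.sum_congr rfl fun V hV => ?_
    obtain ⟨hV, hex⟩ := Finset.mem_filter.1 hV
    obtain ⟨hVn, hVP⟩ := Finset.subset_sdiff.1 (Finset.mem_powerset.1 hV)
    exact Pinnacle.card_pinnacleSet_valeSet hn hPn hVn hVP.symm hex
  have hexp : (n : ℤ) - (P.card : ℤ) - 1 = ((n - (P.card + 1) : ℕ) : ℤ) := by
    push_cast [Nat.cast_sub hlt]
    ring
  rw [hexp, zpow_natCast]
  exact_mod_cast congrArg (Int.cast : ℤ → ℚ) hint
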